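/- Let $\mathcal A$ be a unital $C^*$-algebra, let $\mathcal H$ be a complex Hilbert space, let $B(\mathcal H)$ be the algebra of bounded operators on $\mathcal H$, and let $\varphi:\mathcal A\to B(\mathcal H)$ be a completely positive (CP) linear map. A minimal Stinespring triple of $\varphi$ is a triple $(\mathcal K,\pi,V)$ consisting of a Hilbert space $\mathcal K$, a unital $*$-representation $\pi:\mathcal A\to B(\mathcal K)$ and a bounded linear map $V:\mathcal H\to\mathcal K$ such that $\varphi(X)=V^*\pi(X)V$ for all $X\in\mathcal A$ and $\overline{\operatorname{span}}\{\pi(X)Vh: X\in\mathcal A,\ h\in\mathcal H\}=\mathcal K$; it is unique up to unitary equivalence. The map $\varphi$ is called quasi-pure if, for its minimal Stinespring triple $(\mathcal K,\pi,V)$, every nonzero vector $g$ in the range of $V$ is cyclic for $\pi$, that is, $\overline{\operatorname{span}}\{\pi(X)g: X\in\mathcal A\}=\mathcal K$. A CP map $\alpha:\mathcal A\to B(\mathcal H)$ is said to be dominated by $\varphi$ if $\varphi-\alpha$ is CP. **Theorem.** The map $\varphi$ is quasi-pure if and only if $$\ker(\alpha(1))=\ker(\varphi(1))$$ for every nonzero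 CP map $\alpha:\mathcal A\to B(\mathcal H)$ dominated by $\varphi$. -/

import Mathlib

open scoped CStarAlgebra

namespace QuasiPureCP

section Domination

variable {A B : Type*}
  [NonUnitalCStarAlgebra A] [PartialOrder A] [StarOrderedRing A]
  [NonUnitalCStarAlgebra B] [PartialOrder B] [StarOrderedRing B]

/-- The CP map `α` is dominated by the CP map `φ`: the linear map `φ - α` is completely
positive. -/
def IsDominatedBy (α φ : A →CP B) : Prop :=
  ∃ δ : A →CP B, δ.toLinearMap = φ.toLinearMap - α.toLinearMap

end Domination

section Representations

variable {A H K : Type*} [CStarAlgebra A]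
  [NormedAddCommGroup H] [InnerProductSpace ℂ H] [CompleteSpace H]
  [NormedAddCommGroup K] [InnerProductSpace ℂ K] [CompleteSpace K]

/-- The vector `v` is cyclic for the representation `π`: the closed linear span of
`{π X v : X ∈ A}` is the whole space. -/
def IsCyclicVector (π : A →⋆ₐ[ℂ] (K →L[ℂ] K)) (v : K) : Prop :=
  (Submodule.span ℂ {k : K | ∃ X : A, k = π X v}).topologicalClosure = ⊤

/-- `(K, π, V)` is a minimal Stinespring triple of `φ : A → B(H)`: `π` is a unital
`*`-representation of `A` on the Hilbert space `K`, `V : H → K` is bounded,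
`φ X = V* π(X) V` for all `X`, and the closed linear span of
`{π X (V h) : X ∈ A, h ∈ H}` is `K`. -/
structure IsMinimalStinespring [PartialOrder A] [StarOrderedRing A]
    (φ : A →CP (H →L[ℂ] H)) (π : A →⋆ₐ[ℂ] (K →L[ℂ] K)) (V : H →L[ℂ] K) : Prop where
  dilation : ∀ X : A, φ X = ContinuousLinearMap.adjoint V ∘L π X ∘L V
  minimal :
    (Submodule.span ℂ {k : K | ∃ (X : A) (h : H), k = π X (V h)}).topologicalClosure = ⊤

/-- Every nonzero vector in the range of `V` is cyclic for `π`. -/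
def RangeCyclic (π : A →⋆ₐ[ℂ] (K →L[ℂ] K)) (V : H →L[ℂ] K) : Prop :=
  ∀ g ∈ Set.range V, g ≠ 0 → IsCyclicVector π g

end Representations

universe u v

/-- The CP map `φ : A → B(H)` is quasi-pure: in its minimal Stinespring triple `(K, π, V)`, every
nonzero vector in the range of `V` is cyclic for `π`. The minimal triple is unique up to unitary
equivalence; the definition says both that there is one and that all of them have the property,
so it neither holds vacuously nor depends on a choice. The universe of `K` is the one in which
the usual construction, a completion of a quotient of `A ⊗ H`, lives. -/
def IsQuasiPure {A : Type u} {H : Type v} [CStarAlgebra A] [PartialOrder A] [StarOrderedRing A]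
    [NormedAddCommGroup H] [InnerProductSpace ℂ H] [CompleteSpace H]
    (φ : A →CP (H →L[ℂ] H)) : Prop :=
  (∃ (K : Type (max u v)) (_ : NormedAddCommGroup K) (_ : InnerProductSpace ℂ K)
      (_ : CompleteSpace K) (π : A →⋆ₐ[ℂ] (K →L[ℂ] K)) (V : H →L[ℂ] K),
      IsMinimalStinespring φ π V) ∧
  ∀ (K : Type (max u v)) [NormedAddCommGroup K] [InnerProductSpace ℂ K] [CompleteSpace K]
    (π : A →⋆ₐ[ℂ] (K →L[ℂ] K)) (V : H →L[ℂ] K),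
    IsMinimalStinespring φ π V → RangeCyclic π V

end QuasiPureCP

open scoped InnerProductSpace TensorProduct

/-! ### Positivity in C*-algebras and of operator matrices -/

section NonUnital

variable {B : Type*} [NonUnitalCStarAlgebra B] [PartialOrder B] [StarOrderedRing B]

/-! Since φ(1) = V*V, the kernel of φ(1) is that of V. If α is dominated by φ and has minimal
dilation (ρ, W), positivity of φ − α makes π(X)Vh ↦ ρ(X)Wh norm-decreasing on differences
(`IsDominatedBy.norm_sub_le`). So Vh = 0 forces Wh = 0; and if Wh = 0 while Vh is cyclic,
approximating π(Y)Vk by vectors π(X)Vh gives ρ(Y)Wk = 0, hence α = 0.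

Conversely, for Vh ≠ 0 let P project onto the closure of π(A)Vh, which reduces π. The compression of
π by (1 − P)V is dominated by φ, and its value at 1 kills h whereas φ(1) does not, so it is zero.
Thus V maps into the range of P, and minimality makes Vh cyclic.

This needs Stinespring dilations, built by completing A ⊗ H, and complete positivity of
compressions, obtained from a quadratic-form test for operator matrices. -/

lemma exists_eq_star_mul_self_of_nonneg {a : B} (ha : 0 ≤ a) : ∃ b : B, a = star b * b :=
  CStarAlgebra.nonneg_iff_eq_star_mul_self.mp ha

/-- A self-adjoint element none of whose conjugates is strictly negative is nonnegative. -/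
lemma nonneg_of_forall_conjugate_eq_neg {a : B} (ha : IsSelfAdjoint a)
    (h : ∀ b c : B, star b * a * b = -(star c * c) → c = 0) : 0 ≤ a := by
  have hsa : star a⁻ = a⁻ := (CFC.negPart_nonneg a).isSelfAdjoint.star_eq
  obtain ⟨c, hc⟩ := CStarAlgebra.nonneg_iff_eq_star_mul_self.mp (CFC.negPart_nonneg a)
  have hca : c * a⁻ = 0 := by
    -- With a⁻ = c*c, conjugating a by a⁻ gives −(a⁻)³ = −(ca⁻)*(ca⁻).
    refine h a⁻ _ ?_
    have h1 : a⁻ * a = -(a⁻ * a⁻) := by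
      nth_rewrite 2 [← CFC.posPart_sub_negPart a ha]
      rw [mul_sub, CFC.negPart_mul_posPart, zero_sub]
    rw [star_mul, hsa, h1, mul_assoc (a⁻), ← mul_assoc (star c), ← hc, neg_mul, mul_assoc]
  have hz : a⁻ = 0 := by
    apply CStarRing.star_mul_self_eq_zero_iff _ |>.mp
    rw [hsa]
    nth_rewrite 1 [hc]
    rw [mul_assoc, hca, mul_zero]
  exact (CFC.negPart_eq_zero_iff a ha).mp hz

end NonUnital

namespace CStarMatrix

section OperatorEntries

variable {n H : Type*} [Fintype n]
  [NormedAddCommGroup H] [InnerProductSpace ℂ H] [CompleteSpace H]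

/-- The action of a matrix of bounded operators on tuples of vectors. -/
def act (M : CStarMatrix n n (H →L[ℂ] H)) (h : n → H) (i : n) : H :=
  ∑ j, M i j (h j)

omit [CompleteSpace H] in
lemma act_mul (M N : CStarMatrix n n (H →L[ℂ] H)) (h : n → H) :
    (M * N).act h = M.act (N.act h) := by
  funext i
  simp only [act, mul_apply, _root_.sum_apply, map_sum,
    mul_apply_eq_comp]
  exact Finset.sum_comm

lemma sum_inner_act_star (M : CStarMatrix n n (H →L[ℂ] H)) (g h : n → H) :
    ∑ i, ⟪g i, (star M).act h i⟫_ℂ = ∑ i, ⟪M.act g i, h i⟫_ℂ := by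
  simp only [act, inner_sum, sum_inner, star_apply, ContinuousLinearMap.star_eq_adjoint,
    ContinuousLinearMap.adjoint_inner_right]
  exact Finset.sum_comm

lemma sum_inner_act_star_mul_self (M : CStarMatrix n n (H →L[ℂ] H)) (h : n → H) :
    ∑ i, ⟪h i, (star M * M).act h i⟫_ℂ = ((∑ i, ‖M.act h i‖ ^ 2 : ℝ) : ℂ) := by
  rw [act_mul, sum_inner_act_star]
  simp [inner_self_eq_norm_sq_to_K]

lemma re_sum_inner_act_nonneg {M : CStarMatrix n n (H →L[ℂ] H)} (hM : 0 ≤ M) (h : n → H) :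
    0 ≤ (∑ i, ⟪h i, M.act h i⟫_ℂ).re := by
  obtain ⟨N, rfl⟩ := exists_eq_star_mul_self_of_nonneg hM
  rw [sum_inner_act_star_mul_self, Complex.ofReal_re]
  positivity

omit [CompleteSpace H] in
lemma eq_zero_of_act_eq_zero {M : CStarMatrix n n (H →L[ℂ] H)} (hM : ∀ h i, M.act h i = 0) :
    M = 0 := by
  classical
  ext i j x
  have := hM (Pi.single j x) i
  rw [act, Finset.sum_eq_single j (by intro k _ hk; simp [Pi.single_eq_of_ne hk]) (by simp)] at this
  simpa using this

/-- A self-adjoint matrix of operators with nonnegative quadratic form is nonnegative. -/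
lemma nonneg_of_re_sum_inner_act_nonneg {M : CStarMatrix n n (H →L[ℂ] H)}
    (hsa : IsSelfAdjoint M) (hM : ∀ h : n → H, 0 ≤ (∑ i, ⟪h i, M.act h i⟫_ℂ).re) : 0 ≤ M := by
  -- If b*Mb = −c*c, the form of M at bh equals −∑‖(ch)ᵢ‖², so ch = 0.
  refine nonneg_of_forall_conjugate_eq_neg hsa fun b c hbc => eq_zero_of_act_eq_zero fun h i => ?_
  have h1 := hM (b.act h)
  have h2 : ∑ i, ⟪b.act h i, M.act (b.act h) i⟫_ℂ = -((∑ i, ‖c.act h i‖ ^ 2 : ℝ) : ℂ) := by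
    rw [← sum_inner_act_star, ← act_mul, ← act_mul, hbc,
      ← sum_inner_act_star_mul_self, ← Finset.sum_neg_distrib]
    simp [act, inner_sum]
  rw [h2, Complex.neg_re, Complex.ofReal_re, Left.nonneg_neg_iff] at h1
  have h3 := (Finset.sum_eq_zero_iff_of_nonneg (fun i _ => sq_nonneg _)).mp
    (le_antisymm h1 (Finset.sum_nonneg fun i _ => sq_nonneg ‖c.act h i‖)) i (Finset.mem_univ i)
  simpa using h3

end OperatorEntries

end CStarMatrix

lemma inner_map_star_apply {A K : Type*} [CStarAlgebra A] [NormedAddCommGroup K]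
    [InnerProductSpace ℂ K] [CompleteSpace K] (π : A →⋆ₐ[ℂ] (K →L[ℂ] K)) (X : A) (x y : K) :
    ⟪x, π (star X) y⟫_ℂ = ⟪π X x, y⟫_ℂ := by
  rw [map_star, ContinuousLinearMap.star_eq_adjoint, ContinuousLinearMap.adjoint_inner_right]

/-! ### Compressions of representations -/

namespace CompletelyPositiveMap

variable {A H K : Type*} [CStarAlgebra A] [PartialOrder A] [StarOrderedRing A]
  [NormedAddCommGroup H] [InnerProductSpace ℂ H] [CompleteSpace H]
  [NormedAddCommGroup K] [InnerProductSpace ℂ K] [CompleteSpace K]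

open ContinuousLinearMap (adjoint)

/-- The compression `X ↦ W* π(X) W` of a `*`-representation. -/
noncomputable def compression (π : A →⋆ₐ[ℂ] (K →L[ℂ] K)) (W : H →L[ℂ] K) :
    A →CP (H →L[ℂ] H) where
  toFun X := adjoint W ∘L π X ∘L W
  map_add' X Y := by ext; simp
  map_smul' c X := by ext; simp
  map_cstarMatrix_nonneg' k M hM := by
    obtain ⟨N, rfl⟩ := exists_eq_star_mul_self_of_nonneg hM
    apply CStarMatrix.nonneg_of_re_sum_inner_act_nonneg
    · ext i j x
      have : star ((star N * N) j i) = (star N * N) i j := by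
        rw [← CStarMatrix.star_apply, star_mul, star_star]
      refine ext_inner_left ℂ fun y => ?_
      rw [CStarMatrix.star_apply, ContinuousLinearMap.star_eq_adjoint,
        ContinuousLinearMap.adjoint_inner_right]
      simp only [CStarMatrix.map_apply, LinearMap.coe_mk, AddHom.coe_mk,
        ContinuousLinearMap.comp_apply, ContinuousLinearMap.adjoint_inner_left,
        ContinuousLinearMap.adjoint_inner_right]
      rw [← this, map_star, ContinuousLinearMap.star_eq_adjoint,
        ContinuousLinearMap.adjoint_inner_right]
    · intro h
      have : ∑ i, ⟪h i, ((star N * N).map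
          (fun X => adjoint W ∘L π X ∘L W)).act h i⟫_ℂ
          = ((∑ l, ‖∑ j, π (N l j) (W (h j))‖ ^ 2 : ℝ) : ℂ) := by
        simp only [CStarMatrix.act, CStarMatrix.map_apply, CStarMatrix.mul_apply,
          CStarMatrix.star_apply, map_sum, map_mul, inner_sum,
          ContinuousLinearMap.comp_apply, ContinuousLinearMap.adjoint_inner_right,
          _root_.sum_apply, mul_apply_eq_comp, inner_map_star_apply]
        have hsq (x : K) : ((‖x‖ ^ 2 : ℝ) : ℂ) = ⟪x, x⟫_ℂ := by
          rw [inner_self_eq_norm_sq_to_K]; simp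
        rw [Complex.ofReal_sum]
        simp only [hsq, sum_inner, inner_sum]
        rw [Finset.sum_comm, Finset.sum_congr rfl fun j _ => Finset.sum_comm, Finset.sum_comm]
      exact (congrArg Complex.re this).symm ▸ (by rw [Complex.ofReal_re]; positivity)

@[simp]
lemma compression_apply (π : A →⋆ₐ[ℂ] (K →L[ℂ] K)) (W : H →L[ℂ] K) (X : A) :
    compression π W X = adjoint W ∘L π X ∘L W := rfl

lemma inner_compression_star_mul (π : A →⋆ₐ[ℂ] (K →L[ℂ] K)) (W : H →L[ℂ] K) (X Y : A) (h k : H) :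
    ⟪h, compression π W (star X * Y) k⟫_ℂ = ⟪π X (W h), π Y (W k)⟫_ℂ := by
  simp [ContinuousLinearMap.adjoint_inner_right, inner_map_star_apply]

end CompletelyPositiveMap

/-! ### The Stinespring construction -/

namespace CompletelyPositiveMap

variable {A H : Type*} [CStarAlgebra A] [PartialOrder A] [StarOrderedRing A]
  [NormedAddCommGroup H] [InnerProductSpace ℂ H] [CompleteSpace H]
  (φ : A →CP (H →L[ℂ] H))

lemma map_star_apply (X : A) : φ (star X) = star (φ X) := by
  let ψ : A →ₚ[ℂ] (H →L[ℂ] H) := PositiveLinearMap.mk₀ φ.toLinearMap fun _ h => map_nonneg φ h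
  exact map_star ψ X

/-- The sesquilinear form `⟪a ⊗ h, b ⊗ k⟫ = ⟪h, φ (a* b) k⟫` on `A ⊗ H`. -/
noncomputable def stinespringForm : A ⊗[ℂ] H →ₗ⋆[ℂ] A ⊗[ℂ] H →ₗ[ℂ] ℂ :=
  TensorProduct.lift <| LinearMap.mk₂'ₛₗ (starRingEnd ℂ) (starRingEnd ℂ)
    (fun a h => TensorProduct.lift <| LinearMap.mk₂' ℂ ℂ (fun b k => ⟪h, φ (star a * b) k⟫_ℂ)
      (fun _ _ _ => by simp [mul_add])
      (fun _ _ _ => by simp)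
      (fun _ _ _ => by simp)
      (fun _ _ _ => by simp))
    (fun _ _ _ => by ext; simp [add_mul])
    (fun _ _ _ => by ext; simp)
    (fun _ _ _ => by ext; simp)
    (fun _ _ _ => by ext; simp [mul_comm])

@[simp]
lemma stinespringForm_tmul (a b : A) (h k : H) :
    φ.stinespringForm (a ⊗ₜ h) (b ⊗ₜ k) = ⟪h, φ (star a * b) k⟫_ℂ := rfl

lemma conj_stinespringForm (x y : A ⊗[ℂ] H) :
    starRingEnd ℂ (φ.stinespringForm y x) = φ.stinespringForm x y := by
  induction x with
  | zero => simp
  | add x₁ x₂ h₁ h₂ => simp [h₁, h₂]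
  | tmul a h =>
    induction y with
    | zero => simp
    | add y₁ y₂ h₁ h₂ => simp [h₁, h₂]
    | tmul b k =>
      rw [stinespringForm_tmul, stinespringForm_tmul, inner_conj_symm,
        ← ContinuousLinearMap.adjoint_inner_right, ← ContinuousLinearMap.star_eq_adjoint,
        ← map_star_apply, star_mul, star_star]

lemma re_stinespringForm_self_nonneg (x : A ⊗[ℂ] H) : 0 ≤ (φ.stinespringForm x x).re := by
  obtain ⟨S, rfl⟩ := TensorProduct.exists_finset x
  rcases isEmpty_or_nonempty S with hS | ⟨⟨s₀⟩⟩
  · simp [Finset.isEmpty_coe_sort.mp hS]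
  classical
  -- The only nonzero row of N lists the A-components of the tensors, so N*N is the positive matrix
  -- (aᵢ*aⱼ).
  let N : CStarMatrix S S A := CStarMatrix.ofMatrix fun i j => if i = s₀ then j.1.1 else 0
  have hNa (i j : S) : N i j = if i = s₀ then j.1.1 else 0 := rfl
  have hN (i j : S) : (star N * N) i j = star i.1.1 * j.1.1 := by
    rw [CStarMatrix.mul_apply, Finset.sum_eq_single s₀]
    · simp [hNa, CStarMatrix.star_apply]
    · intro l _ hl
      simp [hNa, CStarMatrix.star_apply, hl]
    · simp
  have h := CStarMatrix.re_sum_inner_act_nonneg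
    (φ.map_cstarMatrix_nonneg (star N * N) (star_mul_self_nonneg N)) fun i => i.1.2
  convert h using 2
  rw [← Finset.sum_coe_sort S]
  simp only [map_sum, LinearMap.sum_apply, stinespringForm_tmul, CStarMatrix.act,
    CStarMatrix.map_apply, hN, inner_sum]
  exact Finset.sum_comm

set_option linter.unusedVariables false in
/-- The algebraic tensor product `A ⊗ H` with the semi-inner product defined by `φ`. -/
@[nolint unusedArguments]
def PreStinespring (φ : A →CP (H →L[ℂ] H)) := A ⊗[ℂ] H

namespace PreStinespring

noncomputable instance : AddCommGroup φ.PreStinespring := inferInstanceAs (AddCommGroup (A ⊗[ℂ] H))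
noncomputable instance : Module ℂ φ.PreStinespring := inferInstanceAs (Module ℂ (A ⊗[ℂ] H))

/-- The semi-inner product on the pre-Stinespring space. -/
noncomputable abbrev core : PreInnerProductSpace.Core ℂ φ.PreStinespring where
  inner x y := φ.stinespringForm x y
  conj_inner_symm x y := φ.conj_stinespringForm x y
  re_inner_nonneg x := φ.re_stinespringForm_self_nonneg x
  add_left x y z := LinearMap.congr_fun (map_add φ.stinespringForm x y) z
  smul_left x y c := LinearMap.congr_fun (map_smulₛₗ φ.stinespringForm c x) y

noncomputable instance : SeminormedAddCommGroup φ.PreStinespring :=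
  InnerProductSpace.Core.toSeminormedAddCommGroup (c := core φ)
noncomputable instance : InnerProductSpace ℂ φ.PreStinespring :=
  InnerProductSpace.ofCore (core φ)

/-- Pure tensors in the pre-Stinespring space. -/
noncomputable def tmul : A →ₗ[ℂ] H →ₗ[ℂ] φ.PreStinespring := TensorProduct.mk ℂ A H

variable {φ}

@[elab_as_elim]
lemma induction_on {p : φ.PreStinespring → Prop} (x : φ.PreStinespring)
    (zero : p 0) (tmul : ∀ a h, p (tmul φ a h)) (add : ∀ x y, p x → p y → p (x + y)) : p x :=
  TensorProduct.induction_on x zero tmul add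

@[simp]
lemma inner_tmul (a b : A) (h k : H) : ⟪tmul φ a h, tmul φ b k⟫_ℂ = ⟪h, φ (star a * b) k⟫_ℂ := rfl

variable (φ) in
/-- Left multiplication on the pre-Stinespring space. -/
noncomputable def mulLeft (X : A) : φ.PreStinespring →ₗ[ℂ] φ.PreStinespring :=
  LinearMap.rTensor H (LinearMap.mulLeft ℂ X)

@[simp]
lemma mulLeft_tmul (X a : A) (h : H) : mulLeft φ X (tmul φ a h) = tmul φ (X * a) h := rfl

lemma ext_tmul {E : Type*} [AddCommGroup E] [Module ℂ E] {f g : φ.PreStinespring →ₗ[ℂ] E}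
    (h : ∀ a k, f (tmul φ a k) = g (tmul φ a k)) : f = g :=
  TensorProduct.ext' h

lemma mulLeft_one : mulLeft φ 1 = LinearMap.id := ext_tmul fun _ _ => by simp

lemma mulLeft_mul (X Y : A) : mulLeft φ (X * Y) = mulLeft φ X ∘ₗ mulLeft φ Y :=
  ext_tmul fun _ _ => by simp [mul_assoc]

lemma mulLeft_add (X Y : A) : mulLeft φ (X + Y) = mulLeft φ X + mulLeft φ Y :=
  ext_tmul fun _ _ => by simp [add_mul]

lemma mulLeft_smul (c : ℂ) (X : A) : mulLeft φ (c • X) = c • mulLeft φ X :=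
  ext_tmul fun _ _ => by simp

lemma inner_mulLeft (X : A) (x y : φ.PreStinespring) :
    ⟪mulLeft φ X x, y⟫_ℂ = ⟪x, mulLeft φ (star X) y⟫_ℂ := by
  induction x using induction_on with
  | zero => simp
  | add x₁ x₂ h₁ h₂ => simp [h₁, h₂, inner_add_left]
  | tmul a h =>
    induction y using induction_on with
    | zero => simp
    | add y₁ y₂ h₁ h₂ => rw [map_add, inner_add_right, inner_add_right, h₁, h₂]
    | tmul b k => simp [mul_assoc]

/-- Writing ‖X‖² − X*X = C*C turns the bound into ‖Cx‖² + ‖Xx‖² = ‖X‖²‖x‖². -/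
lemma norm_mulLeft_le (X : A) (x : φ.PreStinespring) : ‖mulLeft φ X x‖ ≤ ‖X‖ * ‖x‖ := by
  have hX : star X * X ≤ algebraMap ℝ A (‖X‖ ^ 2) := by
    rw [sq, ← CStarRing.norm_star_mul_self]
    exact IsSelfAdjoint.le_algebraMap_norm_self
  obtain ⟨C, hC⟩ := CStarAlgebra.nonneg_iff_eq_star_mul_self.mp (sub_nonneg.mpr hX)
  have hself (Y : A) : ⟪x, mulLeft φ (star Y * Y) x⟫_ℂ = (‖mulLeft φ Y x‖ : ℂ) ^ 2 := by
    rw [mulLeft_mul, LinearMap.comp_apply, ← inner_mulLeft, inner_self_eq_norm_sq_to_K]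
    rfl
  have h1 : mulLeft φ (star C * C) + mulLeft φ (star X * X) = ((‖X‖ : ℂ) ^ 2) • LinearMap.id := by
    rw [← mulLeft_add, ← hC, sub_add_cancel, ← mulLeft_one, ← mulLeft_smul,
      Algebra.algebraMap_eq_smul_one, ← Complex.ofReal_pow, Complex.coe_smul]
  have h2 := congrArg (fun T => ⟪x, T x⟫_ℂ) h1
  simp only [LinearMap.add_apply, inner_add_right, hself, LinearMap.smul_apply, LinearMap.id_apply,
    inner_smul_right, inner_self_eq_norm_sq_to_K, Complex.coe_algebraMap] at h2
  have h3 : ‖mulLeft φ C x‖ ^ 2 + ‖mulLeft φ X x‖ ^ 2 = ‖X‖ ^ 2 * ‖x‖ ^ 2 := by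
    exact_mod_cast h2
  refine (sq_le_sq₀ (norm_nonneg _) (by positivity)).mp ?_
  rw [mul_pow, ← h3]
  exact le_add_of_nonneg_left (sq_nonneg _)

variable (φ) in
/-- Left multiplication on the pre-Stinespring space as a bounded operator. -/
noncomputable def mulLeftL (X : A) : φ.PreStinespring →L[ℂ] φ.PreStinespring :=
  (mulLeft φ X).mkContinuous ‖X‖ (norm_mulLeft_le X)

@[simp]
lemma mulLeftL_apply (X : A) (x : φ.PreStinespring) : mulLeftL φ X x = mulLeft φ X x := rfl

lemma norm_tmul_one_le (h : H) : ‖tmul φ 1 h‖ ≤ √‖φ 1‖ * ‖h‖ := by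
  refine (sq_le_sq₀ (norm_nonneg _) (by positivity)).mp ?_
  have h1 : ‖tmul φ 1 h‖ ^ 2 = ‖⟪h, φ 1 h⟫_ℂ‖ := by
    rw [← one_mul (1 : A), ← star_one A, ← inner_tmul, star_one, inner_self_eq_norm_sq_to_K]
    simp
  rw [h1, mul_pow, Real.sq_sqrt (norm_nonneg _)]
  calc _ ≤ ‖h‖ * (‖φ 1‖ * ‖h‖) :=
        (norm_inner_le_norm _ _).trans (by gcongr; exact (φ 1).le_opNorm h)
    _ = _ := by ring

end PreStinespring

open UniformSpace UniformSpace.Completion PreStinespring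

/-- The Stinespring space of `φ`. -/
abbrev StinespringSpace := Completion φ.PreStinespring

/-- The Stinespring representation of `φ`. -/
noncomputable def stinespringRep : A →⋆ₐ[ℂ] (φ.StinespringSpace →L[ℂ] φ.StinespringSpace) where
  toFun X := (mulLeftL φ X).completion
  map_one' := by
    ext x
    induction x using Completion.induction_on with
    | hp => apply isClosed_eq <;> fun_prop
    | ih x => simp [mulLeft_one]
  map_mul' X Y := by
    ext x
    induction x using Completion.induction_on with
    | hp => apply isClosed_eq <;> fun_prop
    | ih x => simp [mulLeft_mul]
  map_zero' := by
    ext x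
    induction x using Completion.induction_on with
    | hp => apply isClosed_eq <;> fun_prop
    | ih x =>
      have : mulLeft φ (0 : A) = 0 := by simpa using mulLeft_smul (φ := φ) 0 0
      simp only [ContinuousLinearMap.completion_apply_coe, mulLeftL_apply, this,
        LinearMap.zero_apply, _root_.zero_apply]
      exact Completion.coe_zero
  map_add' X Y := by
    ext x
    induction x using Completion.induction_on with
    | hp => apply isClosed_eq <;> fun_prop
    | ih x => simp [mulLeft_add, Completion.coe_add]
  commutes' c := by
    ext x
    induction x using Completion.induction_on with
    | hp => apply isClosed_eq <;> fun_prop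
    | ih x => simp [Algebra.algebraMap_eq_smul_one, mulLeft_smul, mulLeft_one]
  map_star' X := by
    refine (ContinuousLinearMap.eq_adjoint_iff _ _).mpr fun x y => ?_
    induction x, y using Completion.induction_on₂ with
    | hp => apply isClosed_eq <;> fun_prop
    | ih x y => simp [inner_mulLeft]

lemma stinespringRep_coe (X : A) (x : φ.PreStinespring) :
    φ.stinespringRep X (x : φ.StinespringSpace) = (mulLeft φ X x : φ.StinespringSpace) := by
  simp [stinespringRep]

/-- The Stinespring operator `h ↦ 1 ⊗ h` of `φ`. -/
noncomputable def stinespringMap : H →L[ℂ] φ.StinespringSpace :=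
  toComplL ∘L (tmul φ 1).mkContinuous √‖φ 1‖ norm_tmul_one_le

lemma stinespringMap_apply (h : H) :
    φ.stinespringMap h = ((tmul φ 1 h : φ.PreStinespring) : φ.StinespringSpace) := rfl

/-- Stinespring's theorem. -/
theorem isMinimalStinespring :
    QuasiPureCP.IsMinimalStinespring φ φ.stinespringRep φ.stinespringMap where
  dilation X := by
    ext h
    refine ext_inner_left ℂ fun k => ?_
    simp [ContinuousLinearMap.adjoint_inner_right, stinespringMap_apply, stinespringRep_coe]
  minimal := by
    refine Submodule.dense_iff_topologicalClosure_eq_top.mp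
      (Completion.denseRange_coe.mono ?_)
    rintro _ ⟨x, rfl⟩
    induction x using PreStinespring.induction_on with
    | zero => exact zero_mem _
    | add x y hx hy => rw [Completion.coe_add]; exact add_mem hx hy
    | tmul a h => exact Submodule.subset_span ⟨a, h, by simp [stinespringMap_apply, stinespringRep_coe]⟩

end CompletelyPositiveMap

/-! ### Domination, kernels and cyclic vectors -/

namespace QuasiPureCP

open CompletelyPositiveMap

variable {A H K : Type*} [CStarAlgebra A] [PartialOrder A] [StarOrderedRing A]
  [NormedAddCommGroup H] [InnerProductSpace ℂ H] [CompleteSpace H]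
  [NormedAddCommGroup K] [InnerProductSpace ℂ K] [CompleteSpace K]

namespace IsMinimalStinespring

variable {φ : A →CP (H →L[ℂ] H)} {π : A →⋆ₐ[ℂ] (K →L[ℂ] K)} {V : H →L[ℂ] K}

lemma inner_map_star_mul (hφ : IsMinimalStinespring φ π V) (X Y : A) (h k : H) :
    ⟪h, φ (star X * Y) k⟫_ℂ = ⟪π X (V h), π Y (V k)⟫_ℂ := by
  simp [hφ.dilation, ContinuousLinearMap.adjoint_inner_right, inner_map_star_apply]

lemma map_one_apply_eq_zero_iff (hφ : IsMinimalStinespring φ π V) (h : H) :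
    φ 1 h = 0 ↔ V h = 0 := by
  constructor
  · intro h0
    have := hφ.inner_map_star_mul 1 1 h h
    rw [star_one, one_mul, h0, inner_zero_right, map_one] at this
    exact inner_self_eq_zero.mp this.symm
  · intro h0
    simp [hφ.dilation, h0]

end IsMinimalStinespring

/-- The Stinespring dilation of `φ` dominates that of a dominated map `α` in norm. -/
lemma IsDominatedBy.norm_sub_le {L : Type*} [NormedAddCommGroup L] [InnerProductSpace ℂ L]
    [CompleteSpace L] {φ α : A →CP (H →L[ℂ] H)} (hα : IsDominatedBy α φ)
    {π : A →⋆ₐ[ℂ] (K →L[ℂ] K)} {V : H →L[ℂ] K} (hπ : IsMinimalStinespring φ π V)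
    {ρ : A →⋆ₐ[ℂ] (L →L[ℂ] L)} {W : H →L[ℂ] L} (hρ : IsMinimalStinespring α ρ W)
    (X Y : A) (h k : H) : ‖ρ X (W h) - ρ Y (W k)‖ ≤ ‖π X (V h) - π Y (V k)‖ := by
  obtain ⟨δ, hδ⟩ := hα
  have hδα (Z : A) : φ Z = δ Z + α Z := by
    have : δ Z = φ Z - α Z := LinearMap.congr_fun hδ Z
    rw [this, sub_add_cancel]
  -- The form of φ is the sum of those of δ = φ − α and α, so squared norms in the dilations add up.
  have hsum (X Y : A) (h k : H) : ⟪π X (V h), π Y (V k)⟫_ℂ =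
      ⟪δ.stinespringRep X (δ.stinespringMap h), δ.stinespringRep Y (δ.stinespringMap k)⟫_ℂ
        + ⟪ρ X (W h), ρ Y (W k)⟫_ℂ := by
    rw [← hπ.inner_map_star_mul, ← hρ.inner_map_star_mul,
      ← δ.isMinimalStinespring.inner_map_star_mul, hδα, add_apply, inner_add_right]
  have key : ⟪π X (V h) - π Y (V k), π X (V h) - π Y (V k)⟫_ℂ =
      ⟪δ.stinespringRep X (δ.stinespringMap h) - δ.stinespringRep Y (δ.stinespringMap k),
        δ.stinespringRep X (δ.stinespringMap h) - δ.stinespringRep Y (δ.stinespringMap k)⟫_ℂ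
        + ⟪ρ X (W h) - ρ Y (W k), ρ X (W h) - ρ Y (W k)⟫_ℂ := by
    simp only [inner_sub_left, inner_sub_right, hsum]
    ring
  simp only [inner_self_eq_norm_sq_to_K, Complex.coe_algebraMap] at key
  norm_cast at key
  refine (sq_le_sq₀ (norm_nonneg _) (norm_nonneg _)).mp ?_
  rw [key]
  exact le_add_of_nonneg_left (sq_nonneg _)

/-- The orbit `{π X v}` as a submodule. -/
def orbit (π : A →⋆ₐ[ℂ] (K →L[ℂ] K)) (v : K) : Submodule ℂ K where
  carrier := {k | ∃ X : A, k = π X v}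
  add_mem' := by
    rintro _ _ ⟨X, rfl⟩ ⟨Y, rfl⟩
    exact ⟨X + Y, by simp⟩
  zero_mem' := ⟨0, by simp⟩
  smul_mem' := by
    rintro c _ ⟨X, rfl⟩
    exact ⟨c • X, by simp⟩

omit [PartialOrder A] [StarOrderedRing A] in
lemma isCyclicVector_iff (π : A →⋆ₐ[ℂ] (K →L[ℂ] K)) (v : K) :
    IsCyclicVector π v ↔ (orbit π v).topologicalClosure = ⊤ := by
  rw [IsCyclicVector, show {k : K | ∃ X : A, k = π X v} = orbit π v from rfl,
    Submodule.span_eq]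

omit [PartialOrder A] [StarOrderedRing A] in
lemma map_mem_closure_orbit (π : A →⋆ₐ[ℂ] (K →L[ℂ] K)) (v : K) (X : A) {x : K}
    (hx : x ∈ (orbit π v).topologicalClosure) : π X x ∈ (orbit π v).topologicalClosure := by
  refine map_mem_closure (π X).continuous hx ?_
  rintro _ ⟨Y, rfl⟩
  exact ⟨X * Y, by simp⟩

/-- The kernel condition for a dominated map when all nonzero vectors of the range are cyclic. -/
lemma RangeCyclic.ker_eq {φ α : A →CP (H →L[ℂ] H)} {π : A →⋆ₐ[ℂ] (K →L[ℂ] K)} {V : H →L[ℂ] K}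
    (hV : RangeCyclic π V) (hπ : IsMinimalStinespring φ π V) (h0 : α.toLinearMap ≠ 0)
    (hα : IsDominatedBy α φ) : (α 1).ker = (φ 1).ker := by
  have hρ := α.isMinimalStinespring
  have hle := hα.norm_sub_le hπ hρ
  ext h
  rw [LinearMap.mem_ker, LinearMap.mem_ker, ContinuousLinearMap.coe_coe,
    ContinuousLinearMap.coe_coe, hπ.map_one_apply_eq_zero_iff, hρ.map_one_apply_eq_zero_iff]
  refine ⟨fun hW => ?_, fun hVh => ?_⟩
  · by_contra hVh
    have hcyc := (isCyclicVector_iff π (V h)).mp (hV _ ⟨h, rfl⟩ hVh)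
    have hzero (Y : A) (k : H) : α.stinespringRep Y (α.stinespringMap k) = 0 := by
      refine norm_le_zero_iff.mp (le_of_forall_pos_le_add fun ε hε => ?_)
      have hmem : π Y (V k) ∈ (orbit π (V h)).topologicalClosure := hcyc ▸ Submodule.mem_top
      obtain ⟨_, ⟨X, rfl⟩, hX⟩ := Metric.mem_closure_iff.mp hmem ε hε
      have := hle Y X k h
      rw [hW, map_zero, sub_zero, ← dist_eq_norm (π Y (V k))] at this
      linarith
    refine h0 (LinearMap.ext fun X => ?_)
    change α X = 0
    ext k
    simp [hρ.dilation, hzero]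
  -- The choice X = 1, Y = 0 reads ‖Wh‖ ≤ ‖Vh‖.
  · have := hle 1 0 h h
    simpa [hVh] using this

/-- If the kernel condition holds for all nonzero dominated maps, all nonzero vectors of the range
are cyclic. -/
lemma IsMinimalStinespring.rangeCyclic {φ : A →CP (H →L[ℂ] H)} {π : A →⋆ₐ[ℂ] (K →L[ℂ] K)}
    {V : H →L[ℂ] K} (hπ : IsMinimalStinespring φ π V)
    (hker : ∀ α : A →CP (H →L[ℂ] H), α.toLinearMap ≠ 0 → IsDominatedBy α φ →
      (α 1).ker = (φ 1).ker) : RangeCyclic π V := by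
  rintro _ ⟨h, rfl⟩ hVh
  set M := (orbit π (V h)).topologicalClosure with hM
  have hMc : IsClosed (M : Set K) := Submodule.isClosed_topologicalClosure _
  have : CompleteSpace M := hMc.completeSpace_coe
  have hVM : V h ∈ M := Submodule.le_topologicalClosure _ ⟨1, by simp⟩
  -- Mᗮ is invariant because M is invariant under π(X*); hence the cross terms in `hinner` vanish.
  have hmap (X : A) {x : K} (hx : x ∈ Mᗮ) : π X x ∈ Mᗮ := by
    refine (Submodule.mem_orthogonal _ _).mpr fun u hu => ?_
    rw [← star_star X, inner_map_star_apply]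
    exact (Submodule.mem_orthogonal _ _).mp hx _ (map_mem_closure_orbit π (V h) _ hu)
  let P : K →L[ℂ] K := M.starProjection
  have hP (x : K) : P x ∈ M := M.starProjection_apply_mem x
  have hQ (x : K) : x - P x ∈ Mᗮ := M.sub_starProjection_mem_orthogonal x
  have hinner (X : A) (x y : K) : ⟪x, π X y⟫_ℂ
      = ⟪P x, π X (P y)⟫_ℂ + ⟪x - P x, π X (y - P y)⟫_ℂ := by
    have h1 : ⟪P x, π X (y - P y)⟫_ℂ = 0 :=
      (Submodule.mem_orthogonal _ _).mp (hmap X (hQ y)) _ (hP x)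
    have h2 : ⟪x - P x, π X (P y)⟫_ℂ = 0 :=
      (Submodule.mem_orthogonal' _ _).mp (hQ x) _ (map_mem_closure_orbit π (V h) X (hP y))
    conv_lhs => rw [← add_sub_cancel (P x) x, ← add_sub_cancel (P y) y]
    rw [map_add, inner_add_left, inner_add_right, inner_add_right, h1, h2]
    ring
  let α := compression π (V - P ∘L V)
  have hα : IsDominatedBy α φ := by
    refine ⟨compression π (P ∘L V), LinearMap.ext fun X => ?_⟩
    change compression π (P ∘L V) X = φ X - compression π (V - P ∘L V) X
    ext k
    refine ext_inner_left ℂ fun l => ?_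
    have := hinner X (V l) (V k)
    simp only [sub_apply, inner_sub_right, compression_apply, hπ.dilation,
      ContinuousLinearMap.comp_apply, ContinuousLinearMap.adjoint_inner_right]
    rw [this, add_sub_cancel_right]
  have hPV : P (V h) = V h := Submodule.starProjection_eq_self_iff.mpr hVM
  have hα1 : α 1 h = 0 := by
    simp [α, hPV]
  have hα0 : α.toLinearMap = 0 := by
    by_contra h0
    have : h ∈ (φ 1).ker := by
      rw [← hker α h0 hα]
      exact hα1
    exact hVh ((hπ.map_one_apply_eq_zero_iff h).mp this)
  have hPk (k : H) : V k ∈ M := by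
    -- At 1, the vanishing compression gives ‖(1 − P)Vk‖² = 0.
    have h1 := inner_compression_star_mul π (V - P ∘L V) 1 1 k k
    have h2 : compression π (V - P ∘L V) (star 1 * 1) = 0 :=
      LinearMap.congr_fun hα0 (star 1 * 1)
    rw [h2] at h1
    have h3 : V k - P (V k) = 0 := by
      rw [_root_.zero_apply, inner_zero_right, map_one] at h1
      exact inner_self_eq_zero.mp h1.symm
    exact Submodule.starProjection_eq_self_iff.mp (sub_eq_zero.mp h3).symm
  rw [isCyclicVector_iff, ← hM, eq_top_iff, ← hπ.minimal]
  refine Submodule.topologicalClosure_minimal _ (Submodule.span_le.mpr ?_) hMc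
  rintro _ ⟨X, k, rfl⟩
  exact map_mem_closure_orbit π (V h) X (hPk k)

end QuasiPureCP

theorem mainTheorem5 {A : Type*} {H : Type*}
    [CStarAlgebra A] [PartialOrder A] [StarOrderedRing A]
    [NormedAddCommGroup H] [InnerProductSpace ℂ H] [CompleteSpace H]
    (φ : A →CP (H →L[ℂ] H)) :
    QuasiPureCP.IsQuasiPure φ ↔
      ∀ α : A →CP (H →L[ℂ] H), α.toLinearMap ≠ 0 → QuasiPureCP.IsDominatedBy α φ →
        (α 1).ker = (φ 1).ker := by
  refine ⟨fun hφ α h0 hα => ?_, fun hker => ⟨?_, ?_⟩⟩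
  · exact (hφ.2 _ _ _ φ.isMinimalStinespring).ker_eq φ.isMinimalStinespring h0 hα
  · exact ⟨_, _, _, inferInstance, _, _, φ.isMinimalStinespring⟩
  · intro K _ _ _ π V hπ
    exact hπ.rangeCyclic hker
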